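/- Let $(q_n)_{n\ge 0}$ and $(a_{n,i} : n\ge 0,\ 0\le i<q_n)$ be nonnegative integers, and define words over $\{0,1\}$ by $w_0=0$ and $$w_{n+1}=w_n1^{a_{n,0}}w_n1^{a_{n,1}}\cdots w_n1^{a_{n,q_n-1}}w_n,\qquad n\ge 0.$$ The associated Ferenczi subshift is the set $X\subseteq\{0,1\}^{\mathbb Z}$ of all two-sided sequences each of whose finite factors is a factor of some $w_n$, with the product topology and the shift $S:X\to X$, $(Sx)_n=x_{n+1}$. Two points $x,y\in X$ are asymptotic if $d(S^nx,S^ny)\to 0$ as $n\to+\infty$, where $d$ is a metric inducing the topology of $X$. Write $x\sim y$ if $x$ is asymptotic to $S^ky$ for some $k\in\mathbb Z$; this is an equivalence relation. An asymptotic class is an equivalence class of $\sim$ that is not the orbit $\{S^nx:n\in\mathbb Z\}$ of a single point. An automorphism of $(X,S)$ is a homeomorphism $\phi:X\to X$ with $\phi\circ S=S\circ\phi$. **Proposition.** Suppose that $X$ is nonempty, that $(X,S)$ is minimal (every orbit $\{S^nx:n\in\mathbb Z\}$ is dense in $X$) and that it is aperiodic ($S^nx\ne x$ for all $x\in X$ and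 $n\ge 1$). Then $(X,S)$ has exactly one asymptotic class. Moreover, the automorphism group of $(X,S)$ is generated by the shift: $\operatorname{Aut}(X,S)=\{S^n:n\in\mathbb Z\}$. -/

import Mathlib

open Filter Topology Uniformity

/-! ### Topological dynamical systems -/

namespace TopDyn

section

variable {X : Type*}

/-- The system `(X, T)` is minimal: every two-sided orbit `{T ^ n x : n ∈ ℤ}` is dense. -/
def IsMinimal [TopologicalSpace X] (T : X ≃ₜ X) : Prop :=
  ∀ x : X, Dense (Set.range fun n : ℤ => (T ^ n) x)

/-- The system `(X, T)` is aperiodic: no point `x` satisfies `T ^ n x = x` for some `n > 0`. -/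
def IsAperiodic [TopologicalSpace X] (T : X ≃ₜ X) : Prop :=
  ∀ x : X, ∀ n : ℕ, 0 < n → (T ^ n) x ≠ x

/-- `x` and `y` are asymptotic: `T ^ n x` and `T ^ n y` become arbitrarily close as `n → +∞`.
On a compact space this is `d (T ^ n x) (T ^ n y) → 0` for any (equivalently, every) metric `d`
inducing the topology, see `isAsymptotic_iff_dist`. -/
def IsAsymptotic [UniformSpace X] (T : X ≃ₜ X) (x y : X) : Prop :=
  Tendsto (fun n : ℕ => ((T ^ n) x, (T ^ n) y)) atTop (𝓤 X)

theorem isAsymptotic_iff_dist [u : UniformSpace X] [CompactSpace X] (T : X ≃ₜ X)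
    (m : MetricSpace X)
    (hm : m.toPseudoMetricSpace.toUniformSpace.toTopologicalSpace = u.toTopologicalSpace)
    (x y : X) :
    IsAsymptotic T x y ↔
      Tendsto (fun n : ℕ => m.dist ((T ^ n) x) ((T ^ n) y)) atTop (𝓝 0) := by
  have hu : m.toPseudoMetricSpace.toUniformSpace = u :=
    unique_uniformity_of_compact (t := u.toTopologicalSpace) hm rfl
  unfold IsAsymptotic
  subst hu
  exact tendsto_uniformity_iff_dist_tendsto_zero

theorem IsAsymptotic.zpow [UniformSpace X] {T : X ≃ₜ X} {x y : X} (h : IsAsymptotic T x y)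
    (k : ℤ) : IsAsymptotic T ((T ^ k) x) ((T ^ k) y) := by
  have ht : Tendsto (fun n : ℕ => ((n : ℤ) + k).toNat) atTop atTop := by
    refine tendsto_atTop.2 fun b => ?_
    filter_upwards [eventually_ge_atTop (b + k.natAbs)] with n hn
    omega
  refine (h.comp ht).congr' ?_
  filter_upwards [eventually_ge_atTop k.natAbs] with n hn
  have e : T ^ n * T ^ k = T ^ ((n : ℤ) + k).toNat := by
    rw [← zpow_natCast, ← zpow_natCast, ← zpow_add, Int.toNat_of_nonneg (by omega)]
  simp only [Function.comp, ← e]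
  rfl

/-- The equivalence relation `x ∼ y`: `x` is asymptotic to `T ^ k y` for some `k ∈ ℤ`. -/
def asymptoticSetoid [UniformSpace X] (T : X ≃ₜ X) : Setoid X where
  r x y := ∃ k : ℤ, IsAsymptotic T x ((T ^ k) y)
  iseqv := by
    have key : ∀ (j k : ℤ) (z : X), (T ^ j) ((T ^ k) z) = (T ^ (j + k)) z := by
      intro j k z
      rw [zpow_add]
      rfl
    refine ⟨fun x => ⟨0, ?_⟩, ?_, ?_⟩
    · exact tendsto_diag_uniformity (fun n : ℕ => (T ^ n) x) atTop
    · rintro x y ⟨k, hk⟩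
      refine ⟨-k, ?_⟩
      have h := hk.zpow (-k)
      rw [key, neg_add_cancel] at h
      exact tendsto_swap_uniformity.comp h
    · rintro x y z ⟨k, hk⟩ ⟨l, hl⟩
      refine ⟨k + l, ?_⟩
      have h := hl.zpow k
      rw [key] at h
      exact hk.uniformity_trans h

/-- An asymptotic class: an equivalence class of `∼` that is not the orbit of a single point. -/
def IsAsymptoticClass [UniformSpace X] (T : X ≃ₜ X) (C : Set X) : Prop :=
  C ∈ (asymptoticSetoid T).classes ∧ ∀ x : X, C ≠ Set.range fun n : ℤ => (T ^ n) x

/-- The group `Aut(X, T)` of homeomorphisms `φ` of `X` with `φ ∘ T = T ∘ φ`. -/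
def automorphismGroup [TopologicalSpace X] (T : X ≃ₜ X) : Subgroup (X ≃ₜ X) where
  carrier := {φ | ∀ x : X, φ (T x) = T (φ x)}
  one_mem' := fun _ => rfl
  mul_mem' := by
    intro φ ψ hφ hψ x
    change φ (ψ (T x)) = T (φ (ψ x))
    rw [hψ x, hφ (ψ x)]
  inv_mem' := by
    intro φ hφ x
    change φ.symm (T x) = T (φ.symm x)
    rw [Homeomorph.symm_apply_eq, hφ, Homeomorph.apply_symm_apply]

end

end TopDyn

/-! ### Ferenczi subshifts -/

namespace Ferenczi

/-- The discrete uniformity on the alphabet `{0, 1}`. -/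
instance alphabetUniformSpace : UniformSpace (Fin 2) := ⊥

instance : DiscreteUniformity (Fin 2) := ⟨rfl⟩

/-- The generating words `w 0 = 0` and
`w (n + 1) = w n 1 ^ (a n 0) w n 1 ^ (a n 1) … w n 1 ^ (a n (q n - 1)) w n`
with cutting parameters `q n` and spacer parameters `a n i`, `i < q n`
(the values `a n i` with `i ≥ q n` are not used). -/
def word (q : ℕ → ℕ) (a : ℕ → ℕ → ℕ) : ℕ → List (Fin 2)
  | 0 => [0]
  | n + 1 =>
      (List.range (q n)).flatMap (fun i => word q a n ++ List.replicate (a n i) 1) ++ word q a n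

/-- The word `x_m x_{m+1} … x_{m+l-1}`. -/
def factor (x : ℤ → Fin 2) (m : ℤ) (l : ℕ) : List (Fin 2) :=
  List.ofFn fun i : Fin l => x (m + (i : ℕ))

/-- The set of two-sided sequences all of whose factors are factors of some generating word.
It carries the topology (and uniformity) induced by the product `{0, 1} ^ ℤ`. -/
def subshift (q : ℕ → ℕ) (a : ℕ → ℕ → ℕ) : Set (ℤ → Fin 2) :=
  {x | ∀ (m : ℤ) (l : ℕ), ∃ n : ℕ, factor x m l <:+: word q a n}

theorem isClosed_subshift (q : ℕ → ℕ) (a : ℕ → ℕ → ℕ) : IsClosed (subshift q a) := by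
  have h : subshift q a = ⋂ (m : ℤ) (l : ℕ),
      (fun (x : ℤ → Fin 2) (i : Fin l) => x (m + (i : ℕ))) ⁻¹'
        {v | ∃ n : ℕ, List.ofFn v <:+: word q a n} := by
    ext x
    simp [subshift, factor]
  rw [h]
  refine isClosed_iInter fun m => isClosed_iInter fun l => ?_
  exact (isClosed_discrete _).preimage (by fun_prop)

instance (q : ℕ → ℕ) (a : ℕ → ℕ → ℕ) : CompactSpace (subshift q a) :=
  isCompact_iff_compactSpace.1 (isClosed_subshift q a).isCompact

theorem translate_mem {q : ℕ → ℕ} {a : ℕ → ℕ → ℕ} {x : ℤ → Fin 2} (hx : x ∈ subshift q a)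
    (k : ℤ) : (fun n => x (n + k)) ∈ subshift q a := by
  intro m l
  obtain ⟨n, hn⟩ := hx (m + k) l
  refine ⟨n, ?_⟩
  have e : factor (fun n => x (n + k)) m l = factor x (m + k) l := by
    simp only [factor, add_right_comm]
  rwa [e]

theorem continuous_translate (q : ℕ → ℕ) (a : ℕ → ℕ → ℕ) (k : ℤ) :
    Continuous fun x : subshift q a =>
      (⟨fun n => x.1 (n + k), translate_mem x.2 k⟩ : subshift q a) := by
  refine Continuous.subtype_mk (continuous_pi fun n => ?_) _
  exact (continuous_apply (n + k)).comp continuous_subtype_val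

/-- The shift map `(S x)_n = x_{n+1}` as a homeomorphism of the Ferenczi subshift. -/
def shift (q : ℕ → ℕ) (a : ℕ → ℕ → ℕ) : subshift q a ≃ₜ subshift q a where
  toFun x := ⟨fun n => x.1 (n + 1), translate_mem x.2 1⟩
  invFun x := ⟨fun n => x.1 (n + -1), translate_mem x.2 (-1)⟩
  left_inv x := by ext n; simp
  right_inv x := by ext n; simp
  continuous_toFun := continuous_translate q a 1
  continuous_invFun := continuous_translate q a (-1)

end Ferenczi

/-! Every `word q a n` begins and ends with 0, so it is coded by the numbers of 1s between its
consecutive zeros. On these codes the recursion is of Toeplitz type: the fixed list `a 0 0, …, a 0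
(q 0 - 1)` recurs with one hole per period `q 0 + 1`, and the holes are filled from the gap word of
the shifted parameters (`exists_desubstitution`).

Given two distinct asymptotic points, cut at the first zero after their last disagreement. The gap
sequences agree on `[0, ∞)` and differ at `-1`. Failure of eventual periodicity forces a common
hole, hence equal phases, and the disagreement forces `-1` to be a hole. The fillings inherit the
same assumptions, so by induction the common right half begins with every gap word
(`eq_of_getElem?_gapWord`). Hence nontrivial asymptotic pairs share one right half up to shift;
compactness provides such a pair (`exists_isAsymptotic_pair`).

An automorphism sends such a pair to another one, so the image of one of its points is asymptotic to
a shift of that point. At a limit point of the forward orbit the automorphism equals that power of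
the shift, and minimality spreads the equality (`eq_zpow_of_isAsymptotic`). -/

namespace Ferenczi

/-! ### Gap words -/

/-- The word `0 1 ^ k₁ 0 1 ^ k₂ … 0 1 ^ kₗ 0` with the prescribed gaps between zeros. -/
def decode : List ℕ → List (Fin 2)
  | [] => [0]
  | k :: v => (0 :: List.replicate k 1) ++ decode v

/-- The substitution `b ↦ b u` on words of gaps, with an additional initial `u`. -/
def interleave (u : List ℕ) : List ℕ → List ℕ
  | [] => u
  | b :: v => u ++ b :: interleave u v

/-- The successive gaps between the zeros of `word q a n`. -/
def gapWord : (ℕ → ℕ) → (ℕ → ℕ → ℕ) → ℕ → List ℕ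
  | _, _, 0 => []
  | q, a, n + 1 =>
      interleave ((List.range (q 0)).map (a 0)) (gapWord (fun k => q (k + 1)) (fun k => a (k + 1)) n)

/-- The substitution `0 ↦ w`, `1 ↦ 1`. -/
def substZero (w : List (Fin 2)) (v : List (Fin 2)) : List (Fin 2) :=
  v.flatMap fun c => if c = 0 then w else [1]

theorem substZero_append (w v v' : List (Fin 2)) :
    substZero w (v ++ v') = substZero w v ++ substZero w v' := by
  simp [substZero]

theorem substZero_replicate_one (w : List (Fin 2)) (k : ℕ) :
    substZero w (List.replicate k 1) = List.replicate k 1 := by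
  induction k with
  | zero => rfl
  | succ k ih =>
    rw [List.replicate_succ, ← List.singleton_append, substZero_append, ih]
    simp [substZero]

/-- The definition of `word` peels off the outermost level; peeling off the innermost one instead
allows induction with shifted parameters. -/
theorem word_succ_eq_substZero (q : ℕ → ℕ) (a : ℕ → ℕ → ℕ) (n : ℕ) :
    word q a (n + 1) =
      substZero (word q a 1) (word (fun k => q (k + 1)) (fun k => a (k + 1)) n) := by
  induction n with
  | zero => simp [substZero, word]
  | succ n ih =>
    have h : ∀ l : List ℕ,
        l.flatMap (fun i => word q a (n + 1) ++ List.replicate (a (n + 1) i) 1) =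
          substZero (word q a 1) (l.flatMap fun i =>
            word (fun k => q (k + 1)) (fun k => a (k + 1)) n ++
              List.replicate (a (n + 1) i) 1) := by
      intro l
      induction l with
      | nil => rfl
      | cons i l hl =>
        rw [List.flatMap_cons, List.flatMap_cons, hl, substZero_append, substZero_append,
          substZero_replicate_one, ih]
    calc word q a (n + 2) = _ ++ word q a (n + 1) := rfl
      _ = substZero (word q a 1) (word (fun k => q (k + 1)) (fun k => a (k + 1)) (n + 1)) := by
        rw [h, ih, ← substZero_append]
        rfl

theorem decode_append_cons (u v : List ℕ) (b : ℕ) :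
    decode (u ++ b :: v) = decode u ++ List.replicate b 1 ++ decode v := by
  induction u with
  | nil => simp [decode]
  | cons k u ih => simp [decode, ih]

theorem word_one (q : ℕ → ℕ) (a : ℕ → ℕ → ℕ) :
    word q a 1 = decode ((List.range (q 0)).map (a 0)) := by
  simp only [word]
  generalize List.range (q 0) = l
  induction l with
  | nil => rfl
  | cons i l ih => simp_all [decode]

theorem substZero_decode (u v : List ℕ) :
    substZero (decode u) (decode v) = decode (interleave u v) := by
  induction v with
  | nil => simp [substZero, decode, interleave]
  | cons b v ih =>
    rw [decode, substZero_append, ih, interleave, decode_append_cons, ← List.singleton_append,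
      substZero_append, substZero_replicate_one]
    simp [substZero]

theorem word_eq_decode (q : ℕ → ℕ) (a : ℕ → ℕ → ℕ) (n : ℕ) :
    word q a n = decode (gapWord q a n) := by
  induction n generalizing q a with
  | zero => rfl
  | succ n ih => rw [word_succ_eq_substZero, ih, word_one, substZero_decode, gapWord]

theorem exists_decode_eq_cons (v : List ℕ) : ∃ w, decode v = 0 :: w := by
  cases v <;> simp [decode]

theorem replicate_append_decode_prefix {k l : ℕ} {u v : List ℕ}
    (h : List.replicate k 1 ++ decode u <+: List.replicate l 1 ++ decode v) :
    k = l ∧ decode u <+: decode v := by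
  obtain ⟨u', hu⟩ := exists_decode_eq_cons u
  obtain ⟨v', hv⟩ := exists_decode_eq_cons v
  induction k generalizing l with
  | zero =>
    cases l with
    | zero => simpa using h
    | succ l => simp [hu, List.replicate_succ] at h
  | succ k ih =>
    cases l with
    | zero => simp [hv, List.replicate_succ] at h
    | succ l =>
      simp only [List.replicate_succ, List.cons_append, List.cons_prefix_cons] at h
      simpa using ih h.2

theorem prefix_of_decode_prefix {u v : List ℕ} (h : decode u <+: decode v) : u <+: v := by
  induction u generalizing v with
  | nil => simp
  | cons k u ih =>
    cases v with
    | nil =>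
      obtain ⟨u', hu⟩ := exists_decode_eq_cons u
      have := h.length_le
      simp [decode, hu] at this
    | cons l v =>
      simp only [decode, List.cons_append, List.cons_prefix_cons] at h
      obtain ⟨rfl, h'⟩ := replicate_append_decode_prefix h.2
      exact (List.prefix_cons_inj k).2 (ih h')

theorem decode_infix_of_infix_replicate_append {k : ℕ} {u : List ℕ} {v : List (Fin 2)}
    (h : decode u <:+: List.replicate k 1 ++ v) : decode u <:+: v := by
  obtain ⟨u', hu⟩ := exists_decode_eq_cons u
  induction k with
  | zero => simpa using h
  | succ k ih =>
    rw [List.replicate_succ, List.cons_append, List.infix_cons_iff] at h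
    rcases h with h | h
    · simp [hu] at h
    · exact ih h

/-- A decoded word begins and ends with 0, so each of its gaps is delimited by zeros and must match
a complete gap. -/
theorem infix_of_decode_infix {u v : List ℕ} (h : decode u <:+: decode v) : u <:+: v := by
  induction v with
  | nil =>
    refine (prefix_of_decode_prefix ?_).isInfix
    rw [decode, List.infix_cons_iff] at h
    rcases h with h | h
    · exact h
    · obtain ⟨u', hu⟩ := exists_decode_eq_cons u
      simp [hu] at h
  | cons k v ih =>
    rw [decode, List.cons_append, List.infix_cons_iff] at h
    rcases h with h | h
    · exact (prefix_of_decode_prefix h).isInfix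
    · exact List.infix_cons (ih (decode_infix_of_infix_replicate_append h))

/-- Blocks have length `m + 1`, with the hole at residue `m`; the last block lacks its hole. -/
theorem getElem?_interleave {f : ℕ → ℕ} {m : ℕ} {v : List ℕ} {k b : ℕ}
    (h : (interleave ((List.range m).map f) v)[k]? = some b) :
    (k % (m + 1) < m ∧ b = f (k % (m + 1))) ∨ (k % (m + 1) = m ∧ v[k / (m + 1)]? = some b) := by
  induction v generalizing k with
  | nil =>
    simp only [interleave, List.getElem?_map, Option.map_eq_some_iff] at h
    obtain ⟨c, hc, rfl⟩ := h
    have hk : k < m := by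
      by_contra hk
      simp [hk] at hc
    have : c = k := by simpa [hk] using hc.symm
    subst this
    rw [Nat.mod_eq_of_lt (by omega)]
    exact Or.inl ⟨hk, rfl⟩
  | cons c v ih =>
    rw [interleave] at h
    rcases lt_trichotomy k m with hk | rfl | hk
    · rw [List.getElem?_append_left (by simpa)] at h
      rw [Nat.mod_eq_of_lt (by omega)]
      left
      simp [hk] at h
      exact ⟨hk, h.symm⟩
    · right
      rw [List.getElem?_append_right (by simp)] at h
      rw [Nat.mod_eq_of_lt (by omega), Nat.div_eq_of_lt (by omega)]
      simpa using h
    · obtain ⟨j, rfl⟩ : ∃ j, k = j + (m + 1) := ⟨k - (m + 1), by omega⟩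
      rw [List.getElem?_append_right (by simp; omega)] at h
      have e : j + (m + 1) - m = j + 1 := by omega
      simp only [List.length_map, List.length_range, e, List.getElem?_cons_succ] at h
      rw [Nat.add_mod_right, Nat.add_div_right _ (by omega), 
        List.getElem?_cons_succ]
      exact ih h

/-! ### Two-sided sequences of gaps -/

/-- Two-sided sequences all of whose factors occur in some gap word. -/
def gapShift (q : ℕ → ℕ) (a : ℕ → ℕ → ℕ) : Set (ℤ → ℕ) :=
  {g | ∀ (m : ℤ) (l : ℕ), ∃ n s : ℕ, ∀ i < l, (gapWord q a n)[s + i]? = some (g (m + (i : ℕ)))}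

/-- A two-sided sequence in `gapShift q a` is the fixed word `a 0 0 … a 0 (q 0 - 1)` repeated
periodically, with holes filled by a member of the next gap shift. -/
theorem exists_desubstitution {q : ℕ → ℕ} {a : ℕ → ℕ → ℕ} {g : ℤ → ℕ} (hg : g ∈ gapShift q a) :
    ∃ c : ℕ, c < q 0 + 1 ∧
      (∀ i : ℤ, (i + c) % (q 0 + 1 : ℤ) < q 0 → g i = a 0 ((i + c) % (q 0 + 1 : ℤ)).toNat) ∧
      (fun j : ℤ => g (j * (q 0 + 1) + q 0 - c)) ∈
        gapShift (fun k => q (k + 1)) (fun k => a (k + 1)) := by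
  -- Each window `[-L, L]` occurs in a gap word. By pigeonhole one residue `c` of the position of
  -- its centre serves infinitely many `L`, which gives a single phase for the whole sequence.
  choose N s hs using fun L : ℕ => hg (-(L : ℤ)) (2 * L + 1)
  obtain ⟨⟨c, hcp⟩, hc⟩ := Finite.exists_infinite_fiber
    fun L : ℕ => (⟨(s L + L) % (q 0 + 1), Nat.mod_lt _ (by omega)⟩ : Fin (q 0 + 1))
  have hlarge : ∀ B : ℕ, ∃ L, B ≤ L ∧ (s L + L) % (q 0 + 1) = c := by
    intro B
    obtain ⟨L, hL, hB⟩ := (Set.infinite_coe_iff.1 hc).exists_gt B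
    exact ⟨L, hB.le, congrArg Fin.val hL⟩
  clear hc
  have key : ∀ L : ℕ, ∀ i : ℤ, i.natAbs ≤ L → ∃ n k : ℕ, N L = n + 1 ∧ (k : ℤ) = s L + L + i ∧
      ((k % (q 0 + 1) < q 0 ∧ g i = a 0 (k % (q 0 + 1))) ∨ (k % (q 0 + 1) = q 0 ∧
        (gapWord (fun k => q (k + 1)) (fun k => a (k + 1)) n)[k / (q 0 + 1)]? = some (g i))) := by
    intro L i hi
    have h := hs L (L + i).toNat (by omega)
    have e : -(L : ℤ) + ((L + i).toNat : ℕ) = i := by omega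
    rw [e] at h
    cases hN : N L with
    | zero => simp [hN, gapWord] at h
    | succ n =>
      rw [hN, gapWord] at h
      exact ⟨n, _, rfl, by omega, getElem?_interleave h⟩
  refine ⟨c, hcp, ?_, ?_⟩
  · intro i hi
    obtain ⟨L, hL, hc⟩ := hlarge i.natAbs
    obtain ⟨n, k, -, hk, h⟩ := key L i hL
    have e : (i + c) % (q 0 + 1 : ℤ) = (k % (q 0 + 1) : ℕ) := by
      rw [← hc]
      push_cast
      rw [hk, Int.add_emod_emod, add_comm i]
    rw [e] at hi ⊢
    rcases h with h | h
    · rw [Int.toNat_natCast, h.2]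
    · omega
  · intro m l
    -- This bound keeps the holes `(m + i) * p + q 0 - c` with `i < l` inside `[-L, L]`.
    obtain ⟨L, hL, hc⟩ := hlarge (((m.natAbs + l) * (q 0 + 1)) + q 0 + c)
    set p := q 0 + 1 with hp
    have hpz : (q 0 : ℤ) + 1 = p := by simp [hp]
    have hdiv := Nat.div_add_mod (s L + L) p
    rw [hc] at hdiv
    -- The centre lies in block `e`, so these holes carry the entries `e + (m + i)` of the next gap
    -- word.
    set e := (s L + L) / p with he
    have hmain : ∀ i < l, ∃ n k : ℕ, N L = n + 1 ∧ (k : ℤ) = e + (m + i) ∧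
        (gapWord (fun k => q (k + 1)) (fun k => a (k + 1)) n)[k]? =
          some (g ((m + i) * p + q 0 - c)) := by
      intro i hi
      have hb : (((m + i) * p + q 0 - c : ℤ)).natAbs ≤ L := by
        have h1 : ((m + i) * p : ℤ).natAbs ≤ (m.natAbs + l) * p := by
          rw [Int.natAbs_mul, Int.natAbs_natCast]
          exact Nat.mul_le_mul_right _ (by omega)
        omega
      obtain ⟨n, k, hn, hk, h⟩ := key L _ hb
      have hk' : (k : ℤ) = p * (e + (m + i)) + q 0 := by
        have : ((s L + L : ℕ) : ℤ) = p * e + c := by rw [← hdiv]; push_cast; ring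
        rw [hk]
        push_cast at this
        linear_combination this
      have hq : (q 0 : ℤ) / p = 0 := Int.ediv_eq_zero_of_lt (by omega) (by omega)
      have hmod : k % p = q 0 := by
        zify
        rw [hk', Int.mul_add_emod_self_left, Int.emod_eq_of_lt (by omega) (by omega)]
      have hdv : ((k / p : ℕ) : ℤ) = e + (m + i) := by
        push_cast
        rw [hk', Int.mul_add_ediv_left _ _ (by omega), hq, add_zero]
      rcases h with h | h
      · omega
      · exact ⟨n, k / p, hn, hdv, h.2⟩
    rw [hpz]
    rcases Nat.eq_zero_or_pos l with rfl | hl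
    · exact ⟨0, 0, by simp⟩
    · obtain ⟨n, k, hn, hk, -⟩ := hmain 0 hl
      refine ⟨n, k, fun i hi => ?_⟩
      obtain ⟨n', k', hn', hk', h⟩ := hmain i hi
      obtain rfl : n' = n := by omega
      obtain rfl : k' = k + i := by push_cast at hk; omega
      exact h

/-- `x` is eventually periodic to the right. -/
def EventuallyPeriodic {A : Type*} (x : ℤ → A) : Prop :=
  ∃ (p : ℕ) (K : ℤ), 0 < p ∧ ∀ i, K ≤ i → x (i + p) = x i

/-- If two members of the gap shift agree on `[0, ∞)` but not at `-1`, and are not eventually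
periodic, then their common right half starts with every gap word. -/
theorem eq_of_getElem?_gapWord {q : ℕ → ℕ} {a : ℕ → ℕ → ℕ} {g g' : ℤ → ℕ}
    (hg : g ∈ gapShift q a) (hg' : g' ∈ gapShift q a) (hper : ¬ EventuallyPeriodic g)
    (heq : ∀ i, 0 ≤ i → g i = g' i) (hne : g (-1) ≠ g' (-1)) (n k b : ℕ)
    (hb : (gapWord q a n)[k]? = some b) : g k = b := by
  induction n generalizing q a g g' k b with
  | zero => simp [gapWord] at hb
  | succ n ih =>
    obtain ⟨c, hc, hA, hB⟩ := exists_desubstitution hg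
    obtain ⟨c', hc', hA', hB'⟩ := exists_desubstitution hg'
    set p := q 0 + 1 with hp
    have hpz : (q 0 : ℤ) + 1 = p := by simp [hp]
    rw [hpz] at hA hA' hB hB'
    have hle : ∀ j : ℤ, 0 ≤ j % p ∧ (¬ j % p < q 0 → j % p = q 0) := fun j =>
      ⟨Int.emod_nonneg _ (by omega), fun h => by
        have := Int.emod_lt_of_pos j (b := p) (by omega)
        omega⟩
    -- The fixed part has period `p`, so a failure of this period in the common half is a hole of
    -- both sequences and pins down both phases.
    obtain ⟨i, hi, hi'⟩ : ∃ i : ℤ, 0 ≤ i ∧ g (i + p) ≠ g i := by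
      by_contra! h
      exact hper ⟨p, 0, by omega, h⟩
    have hh : (i + c) % p = q 0 := by
      refine (hle _).2 fun h => hi' ?_
      have e : (i + p + c) % (p : ℤ) = (i + c) % p := by
        rw [add_right_comm, Int.add_emod_right]
      rw [hA i h, hA (i + p) (by rwa [e]), e]
    have hh' : (i + c') % p = q 0 := by
      refine (hle _).2 fun h => hi' ?_
      have e : (i + p + c') % (p : ℤ) = (i + c') % p := by
        rw [add_right_comm, Int.add_emod_right]
      rw [heq i hi, heq (i + p) (by omega), hA' i h, hA' (i + p) (by rwa [e]), e]
    have hcc : c = c' := by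
      have h1 : ((c : ℤ) % p) = c' % p := Int.ModEq.add_left_cancel' i (hh.trans hh'.symm)
      rwa [Int.emod_eq_of_lt (by omega) (by omega), Int.emod_eq_of_lt (by omega) (by omega),
        Int.natCast_inj] at h1
    subst hcc
    -- With equal phases the fixed parts coincide, so the disagreement at `-1` sits in a hole.
    have hm : (-1 + c : ℤ) % p = q 0 := by
      refine (hle _).2 fun h => hne ?_
      rw [hA _ h, hA' _ h]
    have hc0 : c = 0 := by
      by_contra h0
      rw [Int.emod_eq_of_lt (by omega) (by omega)] at hm
      omega
    subst hc0
    simp only [Nat.cast_zero, sub_zero, add_zero] at hA hB hB'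
    have hH : ∀ k b : ℕ, (gapWord (fun k => q (k + 1)) (fun k => a (k + 1)) n)[k]? = some b →
        g ((k : ℤ) * p + q 0) = b := by
      intro k b hb
      refine ih hB hB' ?_ ?_ ?_ k b hb
      -- A period `P` of the filling would give `g` the period `p * P`.
      · rintro ⟨P, K, hP, hK⟩
        refine hper ⟨p * P, K * p, by positivity, fun i hi => ?_⟩
        push_cast
        by_cases h : i % p < q 0
        · rw [hA i h, hA _ (by rwa [Int.add_mul_emod_self_left]), Int.add_mul_emod_self_left]
        · have e : i = i / p * p + q 0 := by
            rw [← (hle i).2 h, mul_comm, Int.mul_ediv_add_emod]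
          have h2 : g ((i / p + P) * p + q 0) = g (i / p * p + q 0) :=
            hK (i / p) ((Int.le_ediv_iff_mul_le (by omega)).2 hi)
          have e2 : (i / p + P) * p + q 0 = i + p * P := by linear_combination -e
          rwa [e2, ← e] at h2
      · exact fun j hj => heq _ (by positivity)
      -- Position `-1` is the hole of index `-1`, so the disagreement passes to the fillings.
      · have e : (-1 : ℤ) * p + q 0 = -1 := by omega
        rwa [e]
    rw [gapWord] at hb
    rcases getElem?_interleave hb with ⟨h1, h2⟩ | ⟨h1, h2⟩
    · rw [hA k (by exact_mod_cast h1), h2]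
      norm_cast
    · rw [← hH _ _ h2]
      have e := Nat.div_add_mod' k p
      rw [h1] at e
      exact_mod_cast congrArg (fun j : ℕ => g j) e.symm

/-! ### Enumeration of the zeros of a two-sided sequence -/

/-- `t` enumerates the zeros of `x` increasingly, starting from a zero at the origin. -/
structure IsZeroEnum (x : ℤ → Fin 2) (t : ℤ → ℤ) : Prop where
  strictMono : StrictMono t
  map_zero : t 0 = 0
  eq_zero_iff : ∀ i, x i = 0 ↔ ∃ k, t k = i

/-- The zeros form a locally finite linear order without endpoints, hence a copy of `ℤ`; the index
is translated to start at the origin. -/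
theorem exists_isZeroEnum {x : ℤ → Fin 2} (h0 : x 0 = 0) (hr : ∀ K, ∃ i, K < i ∧ x i = 0)
    (hl : ∀ K, ∃ i, i < K ∧ x i = 0) : ∃ t, IsZeroEnum x t := by
  classical
  let Z := {i : ℤ // x i = 0}
  have : NoMaxOrder Z := ⟨fun z => let ⟨i, hi, h⟩ := hr z; ⟨⟨i, h⟩, hi⟩⟩
  have : NoMinOrder Z := ⟨fun z => let ⟨i, hi, h⟩ := hl z; ⟨⟨i, h⟩, hi⟩⟩
  have : Nonempty Z := ⟨⟨0, h0⟩⟩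
  let : LocallyFiniteOrder Z := Subtype.instLocallyFiniteOrder _
  let : SuccOrder Z := LinearLocallyFiniteOrder.succOrder Z
  let : PredOrder Z := LinearLocallyFiniteOrder.predOrder Z
  let e : Z ≃o ℤ := orderIsoIntOfLinearSuccPredArch
  refine ⟨fun k => (e.symm (k + e ⟨0, h0⟩)).1, fun k l hkl => ?_, by simp, fun i => ⟨?_, ?_⟩⟩
  · exact e.symm.strictMono (by simpa using hkl)
  · intro hi
    exact ⟨e ⟨i, hi⟩ - e ⟨0, h0⟩, by simp⟩
  · rintro ⟨k, rfl⟩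
    exact (e.symm _).2

theorem fin_two_eq_one_iff {c : Fin 2} : c = 1 ↔ c ≠ 0 := by
  fin_cases c <;> simp

theorem factor_succ (x : ℤ → Fin 2) (m : ℤ) (l : ℕ) :
    factor x m (l + 1) = x m :: factor x (m + 1) l := by
  simp only [factor, List.ofFn_succ, Fin.val_zero, Nat.cast_zero, add_zero, Fin.val_succ,
    List.cons.injEq, true_and]
  congr 1
  ext i
  congr 1
  push_cast
  ring

theorem factor_add (x : ℤ → Fin 2) (m : ℤ) (k l : ℕ) :
    factor x m (k + l) = factor x m k ++ factor x (m + k) l := by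
  induction k generalizing m with
  | zero => simp [factor]
  | succ k ih =>
    have e : m + ((k + 1 : ℕ) : ℤ) = m + 1 + k := by push_cast; ring
    rw [add_right_comm, factor_succ, factor_succ, ih, List.cons_append, e]

theorem factor_eq_replicate {x : ℤ → Fin 2} {m : ℤ} {l : ℕ} {c : Fin 2}
    (h : ∀ i : ℤ, m ≤ i → i < m + l → x i = c) : factor x m l = List.replicate l c := by
  rw [List.eq_replicate_iff]
  refine ⟨by simp [factor], fun b hb => ?_⟩
  obtain ⟨i, rfl⟩ := (List.mem_ofFn' _ _).1 hb
  exact h _ (by omega) (by omega)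

/-- The gaps between consecutive values of `t`. -/
def gaps (t : ℤ → ℤ) (k : ℤ) : ℕ := (t (k + 1) - t k - 1).toNat

namespace IsZeroEnum

variable {x y : ℤ → Fin 2} {t s : ℤ → ℤ}

theorem apply_eq_zero (h : IsZeroEnum x t) (k : ℤ) : x (t k) = 0 :=
  (h.eq_zero_iff _).2 ⟨k, rfl⟩

theorem apply_add_one (h : IsZeroEnum x t) (k : ℤ) : t (k + 1) = t k + 1 + gaps t k := by
  have := h.strictMono (lt_add_one k)
  unfold gaps
  omega

theorem eq_one (h : IsZeroEnum x t) {k i : ℤ} (h1 : t k < i) (h2 : i < t (k + 1)) : x i = 1 := by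
  rw [fin_two_eq_one_iff, Ne, h.eq_zero_iff]
  rintro ⟨l, rfl⟩
  rw [h.strictMono.lt_iff_lt] at h1 h2
  omega

theorem factor_eq_decode (h : IsZeroEnum x t) (m : ℤ) (l : ℕ) :
    factor x (t m) ((t (m + l) - t m).toNat + 1) =
      decode (List.ofFn fun i : Fin l => gaps t (m + (i : ℕ))) := by
  induction l generalizing m with
  | zero => simp [factor, decode, h.apply_eq_zero]
  | succ l ih =>
    have e1 := h.apply_add_one m
    have e2 : t (m + 1) ≤ t (m + 1 + l) := h.strictMono.monotone (by omega)
    have e3 : m + ((l + 1 : ℕ) : ℤ) = m + 1 + l := by push_cast; ring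
    have e4 : (t (m + 1 + l) - t m).toNat + 1 =
        gaps t m + ((t (m + 1 + l) - t (m + 1)).toNat + 1) + 1 := by omega
    rw [e3, e4, factor_succ, factor_add, ← e1, ih, h.apply_eq_zero,
      factor_eq_replicate (c := 1) fun i h1 h2 => h.eq_one (k := m) (by omega) (by omega),
      List.ofFn_succ, decode, List.cons_append]
    simp [add_assoc, add_comm (1 : ℤ)]

theorem gaps_mem_gapShift {q : ℕ → ℕ} {a : ℕ → ℕ → ℕ} (h : IsZeroEnum x t)
    (hx : x ∈ subshift q a) : gaps t ∈ gapShift q a := by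
  intro m l
  obtain ⟨n, hn⟩ := hx (t m) ((t (m + l) - t m).toNat + 1)
  rw [h.factor_eq_decode, word_eq_decode] at hn
  obtain ⟨s, -, hs⟩ := List.infix_iff_getElem?.1 (infix_of_decode_infix hn)
  refine ⟨n, s, fun i hi => ?_⟩
  rw [add_comm, hs i (by simpa using hi)]
  simp

/-- Over one period of the gaps the zeros advance by a constant amount, which is a period of `x`. -/
theorem eventuallyPeriodic (h : IsZeroEnum x t) (hp : EventuallyPeriodic (gaps t)) :
    EventuallyPeriodic x := by
  obtain ⟨p, K, hp, hK⟩ := hp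
  have hD : ∀ n : ℕ, t (K + n + p) - t (K + n) = t (K + p) - t K := by
    intro n
    induction n with
    | zero => simp
    | succ n ih =>
      have e1 := h.apply_add_one (K + n)
      have e2 := h.apply_add_one (K + n + p)
      rw [hK _ (by omega)] at e2
      have e3 : K + ((n + 1 : ℕ) : ℤ) = K + n + 1 := by push_cast; ring
      rw [e3, add_right_comm _ 1]
      omega
  have hD' : ∀ k, K ≤ k → t (k + p) = t k + (t (K + p) - t K) := by
    intro k hk
    have := hD (k - K).toNat
    rw [show K + ((k - K).toNat : ℤ) = k by omega] at this
    omega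
  have hpos : t K < t (K + p) := h.strictMono (by omega)
  refine ⟨(t (K + p) - t K).toNat, t K, by omega, fun i hi => ?_⟩
  have e : i + ((t (K + p) - t K).toNat : ℤ) = i + (t (K + p) - t K) := by omega
  rw [e]
  have hiff : x (i + (t (K + p) - t K)) = 0 ↔ x i = 0 := by
    rw [h.eq_zero_iff, h.eq_zero_iff]
    constructor
    · rintro ⟨k, hk⟩
      have h1 : K + p ≤ k := h.strictMono.le_iff_le.1 (by omega)
      have h2 := hD' (k - p) (by omega)
      rw [sub_add_cancel] at h2
      exact ⟨k - p, by omega⟩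
    · rintro ⟨k, rfl⟩
      exact ⟨k + p, hD' k (h.strictMono.le_iff_le.1 hi)⟩
  by_cases hz : x i = 0
  · rw [hz, hiff.2 hz]
  · rw [fin_two_eq_one_iff.2 hz, fin_two_eq_one_iff.2 (mt hiff.1 hz)]

/-- The right half of a sequence determines the gaps on the right. -/
theorem eq_of_eq_right (hx : IsZeroEnum x t) (hy : IsZeroEnum y s)
    (h : ∀ i, 0 ≤ i → x i = y i) (n : ℕ) : t n = s n := by
  induction n with
  | zero => simp [hx.map_zero, hy.map_zero]
  | succ n ih =>
    have h1 : 0 ≤ t n := by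
      rw [← hx.map_zero]; exact hx.strictMono.monotone (by omega)
    have h2 := hx.strictMono (lt_add_one (n : ℤ))
    have h3 := hy.strictMono (lt_add_one (n : ℤ))
    push_cast
    rcases lt_trichotomy (t (n + 1)) (s (n + 1)) with h4 | h4 | h4
    · have h5 := hy.eq_one (by omega) h4
      rw [← h _ (by omega), hx.apply_eq_zero] at h5
      exact absurd h5 (by simp)
    · exact h4
    · have h5 := hx.eq_one (by omega) h4
      rw [h _ (by omega), hy.apply_eq_zero] at h5
      exact absurd h5 (by simp)

/-- The gaps on the right determine the right half of a sequence. -/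
theorem eq_right_of_gaps_eq (hx : IsZeroEnum x t) (hy : IsZeroEnum y s)
    (h : ∀ n : ℕ, gaps t n = gaps s n) (i : ℤ) (hi : 0 ≤ i) : x i = y i := by
  have hts : ∀ n : ℕ, t n = s n := by
    intro n
    induction n with
    | zero => simp [hx.map_zero, hy.map_zero]
    | succ n ih =>
      push_cast
      rw [hx.apply_add_one, hy.apply_add_one, ih, h]
  have hiff : x i = 0 ↔ y i = 0 := by
    rw [hx.eq_zero_iff, hy.eq_zero_iff]
    constructor
    · rintro ⟨k, rfl⟩
      rw [← hx.map_zero, hx.strictMono.le_iff_le] at hi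
      lift k to ℕ using hi
      exact ⟨k, (hts k).symm⟩
    · rintro ⟨k, rfl⟩
      rw [← hy.map_zero, hy.strictMono.le_iff_le] at hi
      lift k to ℕ using hi
      exact ⟨k, hts k⟩
  by_cases hz : x i = 0
  · rw [hz, hiff.1 hz]
  · rw [fin_two_eq_one_iff.2 hz, fin_two_eq_one_iff.2 (mt hiff.2 hz)]

theorem apply_neg_one_eq (hx : IsZeroEnum x t) {d : ℤ} (hd : d < 0) (hxd : x d = 0)
    (h : ∀ i, d < i → i < 0 → x i ≠ 0) : t (-1) = d := by
  obtain ⟨k, rfl⟩ := (hx.eq_zero_iff d).1 hxd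
  have hk : k < 0 := by rwa [← hx.strictMono.lt_iff_lt, hx.map_zero]
  by_contra hne
  refine h (t (-1)) ?_ ?_ (hx.apply_eq_zero _)
  · exact lt_of_le_of_ne (hx.strictMono.monotone (by omega)) (Ne.symm hne)
  · have := hx.strictMono (show (-1 : ℤ) < 0 by omega)
    rwa [hx.map_zero] at this

/-- Exactly one sequence has a zero at `d`, its last before the origin; equal gaps would put a zero
of the other there too. -/
theorem gaps_neg_one_ne (hx : IsZeroEnum x t) (hy : IsZeroEnum y s) {d : ℤ} (hd : d < 0)
    (hne : x d ≠ y d) (h : ∀ i, d < i → i < 0 → x i ≠ 0 ∧ y i ≠ 0) :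
    gaps t (-1) ≠ gaps s (-1) := by
  have h1 := hx.apply_add_one (-1)
  have h2 := hy.apply_add_one (-1)
  rw [neg_add_cancel, hx.map_zero] at h1
  rw [neg_add_cancel, hy.map_zero] at h2
  intro he
  have hts : t (-1) = s (-1) := by omega
  by_cases hz : x d = 0
  · have h3 := hx.apply_neg_one_eq hd hz fun i hi hi' => (h i hi hi').1
    have h4 := hy.apply_eq_zero (-1)
    rw [← hts, h3] at h4
    exact hne (hz.trans h4.symm)
  · have hz' : y d = 0 := by
      by_contra hz'
      exact hne ((fin_two_eq_one_iff.2 hz).trans (fin_two_eq_one_iff.2 hz').symm)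
    have h3 := hy.apply_neg_one_eq hd hz' fun i hi hi' => (h i hi hi').2
    have h4 := hx.apply_eq_zero (-1)
    rw [hts, h3] at h4
    exact hz h4

end IsZeroEnum

/-! ### The shift and asymptotic pairs -/

section

variable {q : ℕ → ℕ} {a : ℕ → ℕ → ℕ}

theorem shift_zpow_apply (k : ℤ) (x : subshift q a) (i : ℤ) :
    ((shift q a ^ k) x).1 i = x.1 (i + k) := by
  induction k generalizing x i with
  | zero => simp
  | succ k ih =>
    rw [zpow_add_one]
    change ((shift q a ^ (k : ℤ)) (shift q a x)).1 i = _
    rw [ih]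
    change x.1 (i + k + 1) = _
    rw [add_assoc]
  | pred k ih =>
    rw [zpow_sub_one]
    change ((shift q a ^ (-k : ℤ)) ((shift q a).symm x)).1 i = _
    rw [ih]
    exact congrArg x.1 (show i + -k + -1 = i + (-k - 1) by ring)

theorem shift_pow_apply (k : ℕ) (x : subshift q a) (i : ℤ) :
    ((shift q a ^ k) x).1 i = x.1 (i + k) := by
  rw [← zpow_natCast, shift_zpow_apply]

/-- Product uniformity tests finitely many coordinates, and eventual agreement at coordinate 0 along
the orbit already covers a half-line. -/
theorem isAsymptotic_iff {x y : subshift q a} :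
    TopDyn.IsAsymptotic (shift q a) x y ↔ ∃ K : ℤ, ∀ i, K ≤ i → x.1 i = y.1 i := by
  have h : TopDyn.IsAsymptotic (shift q a) x y ↔
      ∀ i : ℤ, ∀ᶠ n : ℕ in atTop, x.1 (i + n) = y.1 (i + n) := by
    unfold TopDyn.IsAsymptotic
    rw [uniformity_subtype, tendsto_comap_iff, Pi.uniformity, tendsto_iInf]
    simp only [tendsto_comap_iff, DiscreteUniformity.eq_principal_setRelId, tendsto_principal,
      Function.comp_apply, SetRel.mem_id, shift_pow_apply]
  rw [h]
  constructor
  · intro h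
    obtain ⟨N, hN⟩ := eventually_atTop.1 (h 0)
    refine ⟨N, fun i hi => ?_⟩
    have := hN i.toNat (by omega)
    rwa [zero_add, Int.toNat_of_nonneg (by omega)] at this
  · rintro ⟨K, hK⟩ i
    filter_upwards [eventually_ge_atTop (K - i).toNat] with n hn
    exact hK _ (by omega)

theorem mem_subshift_of_factor {x y : ℤ → Fin 2} (hx : x ∈ subshift q a)
    (h : ∀ (m : ℤ) (l : ℕ), ∃ m', ∀ i < l, y (m + (i : ℕ)) = x (m' + (i : ℕ))) :
    y ∈ subshift q a := by
  intro m l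
  obtain ⟨m', hm⟩ := h m l
  obtain ⟨n, hn⟩ := hx m' l
  refine ⟨n, ?_⟩
  have e : factor y m l = factor x m' l := by
    unfold factor
    congr 1
    ext1 i
    exact hm i i.2
  rwa [e]

theorem not_periodic (haper : TopDyn.IsAperiodic (shift q a)) {x : ℤ → Fin 2}
    (hx : x ∈ subshift q a) {p : ℕ} (hp : 0 < p) (h : ∀ i, x (i + p) = x i) : False := by
  refine haper ⟨x, hx⟩ p hp (Subtype.ext (funext fun i => ?_))
  rw [shift_pow_apply]
  exact h i

/-- The periodic extension of the tail has only factors of `x`, so it would be a periodic point of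
the subshift. -/
theorem not_eventuallyPeriodic (haper : TopDyn.IsAperiodic (shift q a)) {x : ℤ → Fin 2}
    (hx : x ∈ subshift q a) : ¬ EventuallyPeriodic x := by
  rintro ⟨p, K, hp, h⟩
  have hmul : ∀ (n : ℕ) (i : ℤ), K ≤ i → x (i + n * p) = x i := by
    intro n i hi
    induction n with
    | zero => simp
    | succ n ih =>
      rw [← ih, ← h (i + n * p) (by have : 0 ≤ (n : ℤ) * p := by positivity
                                    omega)]
      congr 1
      push_cast
      ring
  have hmod : ∀ i, K ≤ i → x i = x (K + (i - K) % p) := by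
    intro i hi
    rw [← hmul ((i - K) / p).toNat (K + (i - K) % p)
      (by have := Int.emod_nonneg (i - K) (b := p) (by omega)
          omega),
      Int.toNat_of_nonneg (Int.ediv_nonneg (by omega) (by omega)), add_assoc,
      Int.emod_add_ediv_mul, add_sub_cancel]
  refine not_periodic haper (x := fun i => x (K + (i - K) % p))
    (mem_subshift_of_factor hx fun m l => ?_) hp fun i => ?_
  -- A multiple of `p` moves the window into `[K, ∞)`.
  · refine ⟨m + (K - m).natAbs * p, fun i _ => ?_⟩
    have hb : ((K - m).natAbs : ℤ) ≤ (K - m).natAbs * p :=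
      le_mul_of_one_le_right (by positivity) (by exact_mod_cast hp)
    rw [hmod (m + (K - m).natAbs * p + (i : ℤ)) (by omega)]
    congr 2
    rw [show m + (K - m).natAbs * p + (i : ℤ) - K = m + i - K + (K - m).natAbs * p by ring,
      Int.add_mul_emod_self_right]
  · rw [show i + (p : ℤ) - K = i - K + p by ring, Int.add_emod_right]

theorem not_leftPeriodic (haper : TopDyn.IsAperiodic (shift q a)) {x : ℤ → Fin 2}
    (hx : x ∈ subshift q a) {p : ℕ} (hp : 0 < p) (K : ℤ) (h : ∀ i, i ≤ K → x (i - p) = x i) :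
    False := by
  have hmul : ∀ (n : ℕ) (i : ℤ), i ≤ K → x (i - n * p) = x i := by
    intro n i hi
    induction n with
    | zero => simp
    | succ n ih =>
      rw [← ih, ← h (i - n * p) (by have : 0 ≤ (n : ℤ) * p := by positivity
                                    omega)]
      congr 1
      push_cast
      ring
  have hmod : ∀ i, i ≤ K → x i = x (K - (K - i) % p) := by
    intro i hi
    rw [← hmul ((K - i) / p).toNat (K - (K - i) % p)
      (by have := Int.emod_nonneg (K - i) (b := p) (by omega)
          omega),
      Int.toNat_of_nonneg (Int.ediv_nonneg (by omega) (by omega)), sub_sub,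
      Int.emod_add_ediv_mul, sub_sub_cancel]
  refine not_periodic haper (x := fun i => x (K - (K - i) % p))
    (mem_subshift_of_factor hx fun m l => ?_) hp fun i => ?_
  · refine ⟨m - (m + l - K).natAbs * p, fun i hi => ?_⟩
    have hb : ((m + l - K).natAbs : ℤ) ≤ (m + l - K).natAbs * p :=
      le_mul_of_one_le_right (by positivity) (by exact_mod_cast hp)
    rw [hmod (m - (m + l - K).natAbs * p + (i : ℤ)) (by omega)]
    congr 2
    rw [show K - (m - (m + l - K).natAbs * p + (i : ℤ)) = K - (m + i) + (m + l - K).natAbs * p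
      by ring, Int.add_mul_emod_self_right]
  · rw [show K - (i + (p : ℤ)) = K - i - p by ring, Int.sub_emod_right]

theorem exists_zero_gt (haper : TopDyn.IsAperiodic (shift q a)) {x : ℤ → Fin 2}
    (hx : x ∈ subshift q a) (K : ℤ) : ∃ i, K < i ∧ x i = 0 := by
  by_contra! h
  refine not_eventuallyPeriodic haper hx ⟨1, K + 1, one_pos, fun i hi => ?_⟩
  rw [fin_two_eq_one_iff.2 (h i (by omega)), fin_two_eq_one_iff.2 (h _ (by omega))]

theorem exists_zero_lt (haper : TopDyn.IsAperiodic (shift q a)) {x : ℤ → Fin 2}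
    (hx : x ∈ subshift q a) (K : ℤ) : ∃ i, i < K ∧ x i = 0 := by
  by_contra! h
  refine not_leftPeriodic haper hx one_pos (K - 1) fun i hi => ?_
  rw [fin_two_eq_one_iff.2 (h i (by omega)), fin_two_eq_one_iff.2 (h _ (by omega))]

/-- Up to a shift, the common right half of two distinct asymptotic points starts at a zero, and
its sequence of gaps starts with every gap word. -/
theorem exists_shift_isZeroEnum (haper : TopDyn.IsAperiodic (shift q a)) {x y : subshift q a}
    (hxy : x ≠ y) (h : TopDyn.IsAsymptotic (shift q a) x y) :
    ∃ (k : ℤ) (t : ℤ → ℤ), IsZeroEnum ((shift q a ^ k) x).1 t ∧ gaps t ∈ gapShift q a ∧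
      ∀ n k b : ℕ, (gapWord q a n)[k]? = some b → gaps t k = b := by
  obtain ⟨K, hK⟩ := isAsymptotic_iff.1 h
  obtain ⟨d, hd, hmax⟩ := Int.exists_greatest_of_bdd (P := fun i => x.1 i ≠ y.1 i)
    ⟨K, fun i hi => by
      by_contra hlt
      exact hi (hK i (by omega))⟩
    (by
      by_contra! he
      exact hxy (Subtype.ext (funext he)))
  have hagree : ∀ i, d < i → x.1 i = y.1 i := by
    intro i hi
    by_contra hne
    have := hmax i hne
    omega
  -- The first common zero after the last disagreement `d` becomes the origin, so that `d` affects
  -- exactly the gap of index `-1`.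
  obtain ⟨j, ⟨hj, hj0⟩, hmin⟩ := Int.exists_least_of_bdd
    (P := fun i => d < i ∧ x.1 i = 0) ⟨d, fun i hi => hi.1.le⟩ (exists_zero_gt haper x.2 d)
  have hX := (((shift q a) ^ j) x).2
  have hY := (((shift q a) ^ j) y).2
  obtain ⟨t, ht⟩ := exists_isZeroEnum (x := ((shift q a ^ j) x).1)
    (by rw [shift_zpow_apply, zero_add, hj0]) (exists_zero_gt haper hX) (exists_zero_lt haper hX)
  obtain ⟨s, hs⟩ := exists_isZeroEnum (x := ((shift q a ^ j) y).1)
    (by rw [shift_zpow_apply, zero_add, ← hagree j hj, hj0])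
    (exists_zero_gt haper hY) (exists_zero_lt haper hY)
  have hright : ∀ i, 0 ≤ i → ((shift q a ^ j) x).1 i = ((shift q a ^ j) y).1 i := by
    intro i hi
    rw [shift_zpow_apply, shift_zpow_apply]
    exact hagree _ (by omega)
  refine ⟨j, t, ht, ht.gaps_mem_gapShift hX, eq_of_getElem?_gapWord (ht.gaps_mem_gapShift hX)
    (hs.gaps_mem_gapShift hY) (fun hp => not_eventuallyPeriodic haper hX (ht.eventuallyPeriodic hp))
    ?_ ?_⟩
  · intro i hi
    lift i to ℕ using hi
    have h1 := ht.eq_of_eq_right hs hright i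
    have h2 := ht.eq_of_eq_right hs hright (i + 1)
    push_cast at h2
    rw [gaps, gaps, h1, h2]
  · refine ht.gaps_neg_one_ne hs (d := d - j) (by omega) ?_ ?_
    · rw [shift_zpow_apply, shift_zpow_apply, sub_add_cancel]
      exact hd
    · intro i hi hi'
      rw [shift_zpow_apply, shift_zpow_apply, ← hagree _ (by omega), and_self]
      intro h0
      have := hmin (i + j) ⟨by omega, h0⟩
      omega

/-- Any two nontrivial asymptotic pairs are equivalent. -/
theorem equivalent_of_isAsymptotic (haper : TopDyn.IsAperiodic (shift q a))
    {x y x' y' : subshift q a} (hxy : x ≠ y) (h : TopDyn.IsAsymptotic (shift q a) x y)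
    (hxy' : x' ≠ y') (h' : TopDyn.IsAsymptotic (shift q a) x' y') :
    ∃ k : ℤ, TopDyn.IsAsymptotic (shift q a) x ((shift q a ^ k) x') := by
  obtain ⟨k, t, ht, hg, hw⟩ := exists_shift_isZeroEnum haper hxy h
  obtain ⟨k', t', ht', -, hw'⟩ := exists_shift_isZeroEnum haper hxy' h'
  have heq := ht.eq_right_of_gaps_eq ht' fun m => by
    -- Membership in `gapShift` supplies a gap word longer than `m`, which dictates the gap `m` of
    -- both points.
    obtain ⟨n, s, hs⟩ := hg 0 (m + 1)
    have hlt : m < (gapWord q a n).length := by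
      have := (List.getElem?_eq_some_iff.1 (hs m (by omega))).1
      omega
    have hb := List.getElem?_eq_getElem hlt
    rw [hw n m _ hb, hw' n m _ hb]
  refine ⟨k' - k, isAsymptotic_iff.2 ⟨k, fun i hi => ?_⟩⟩
  have := heq (i - k) (by omega)
  rw [shift_zpow_apply, shift_zpow_apply, sub_add_cancel] at this
  rw [this, shift_zpow_apply]
  exact congrArg x'.1 (by ring)

/-- An aperiodic subshift contains two points that agree exactly to the right of `-1`. -/
theorem exists_isAsymptotic_pair (hne : (subshift q a).Nonempty)
    (haper : TopDyn.IsAperiodic (shift q a)) :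
    ∃ x y : subshift q a, x ≠ y ∧ TopDyn.IsAsymptotic (shift q a) x y := by
  let C : ℕ → Set (subshift q a × subshift q a) := fun L =>
    {z | z.1.1 (-1) ≠ z.2.1 (-1) ∧ ∀ i : ℕ, i < L → z.1.1 i = z.2.1 i}
  have hcont : ∀ i : ℤ, Continuous fun z : subshift q a × subshift q a => (z.1.1 i, z.2.1 i) :=
    fun i =>
    ((continuous_apply i).comp (continuous_subtype_val.comp continuous_fst)).prodMk
      ((continuous_apply i).comp (continuous_subtype_val.comp continuous_snd))
  have hclosed : ∀ L, IsClosed (C L) := by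
    intro L
    have e : C L = (fun z : subshift q a × subshift q a => (z.1.1 (-1), z.2.1 (-1))) ⁻¹'
        {c | c.1 ≠ c.2} ∩ ⋂ (i : ℕ) (_ : i < L),
          (fun z : subshift q a × subshift q a => (z.1.1 i, z.2.1 i)) ⁻¹' {c | c.1 = c.2} := by
      ext z
      simp [C]
    rw [e]
    exact ((isClosed_discrete _).preimage (hcont _)).inter
      (isClosed_iInter fun i => isClosed_iInter fun _ => (isClosed_discrete _).preimage (hcont _))
  have hnonempty : ∀ L, (C L).Nonempty := by
    intro L
    by_contra hempty
    rw [Set.not_nonempty_iff_eq_empty] at hempty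
    -- If `C L` is empty, `L` letters determine the letter to their left. Two equal windows in one
    -- point then propagate leftwards and make it left periodic.
    have hdet : ∀ x y : subshift q a, (∀ i : ℕ, i < L → x.1 i = y.1 i) →
        x.1 (-1) = y.1 (-1) := by
      intro x y hxy
      by_contra hn
      have : (x, y) ∈ C L := ⟨hn, hxy⟩
      simp [hempty] at this
    obtain ⟨x, hx⟩ := hne
    obtain ⟨m, m', hlt, he⟩ : ∃ m m' : ℕ, m < m' ∧ ∀ i : Fin L, x (m + (i : ℕ)) =
        x (m' + (i : ℕ)) := by
      obtain ⟨m, m', hne, he⟩ := Finite.exists_ne_map_eq_of_infinite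
        fun (m : ℕ) (i : Fin L) => x (m + (i : ℕ))
      rcases lt_or_gt_of_ne hne with h | h
      · exact ⟨m, m', h, congrFun he⟩
      · exact ⟨m', m, h, fun i => (congrFun he i).symm⟩
    have hind : ∀ n : ℕ, ∀ i : ℕ, i < L + n → x (m + i - n) = x (m' + i - n) := by
      intro n
      induction n with
      | zero =>
        intro i hi
        simpa using he ⟨i, by simpa using hi⟩
      | succ n ih =>
        intro i hi
        cases i with
        | succ i =>
          have := ih i (by omega)
          push_cast
          rwa [← add_assoc, ← add_assoc, add_sub_add_right_eq_sub, add_sub_add_right_eq_sub]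
        | zero =>
          have := hdet ((shift q a ^ (m - n : ℤ)) ⟨x, hx⟩) ((shift q a ^ (m' - n : ℤ)) ⟨x, hx⟩)
            fun i hi => by
              have := ih i (by omega)
              rw [shift_zpow_apply, shift_zpow_apply]
              convert this using 2 <;> ring
          rw [shift_zpow_apply, shift_zpow_apply] at this
          convert this using 2 <;> push_cast <;> ring
    refine not_leftPeriodic haper hx (p := m' - m) (by omega) (m' - 1) fun i hi => ?_
    have := hind (m' - i).toNat 0 (by omega)
    convert this using 2 <;> push_cast <;> omega
  obtain ⟨⟨x, y⟩, hz⟩ := IsCompact.nonempty_iInter_of_sequence_nonempty_isCompact_isClosed C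
    (fun L z hz => ⟨hz.1, fun i hi => hz.2 i (by omega)⟩) hnonempty (hclosed 0).isCompact hclosed
  rw [Set.mem_iInter] at hz
  refine ⟨x, y, fun h => (hz 0).1 (by rw [h]), isAsymptotic_iff.2 ⟨0, fun i hi => ?_⟩⟩
  lift i to ℕ using hi
  exact (hz (i + 1)).2 i (by omega)

theorem not_isAsymptotic_zpow (haper : TopDyn.IsAperiodic (shift q a)) (x : subshift q a)
    {k : ℤ} (hk : k ≠ 0) : ¬ TopDyn.IsAsymptotic (shift q a) x ((shift q a ^ k) x) := by
  intro h
  obtain ⟨K, hK⟩ := isAsymptotic_iff.1 h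
  simp only [shift_zpow_apply] at hK
  refine not_eventuallyPeriodic haper x.2 ⟨k.natAbs, K + k.natAbs, by omega, fun i hi => ?_⟩
  rcases le_or_gt 0 k with h0 | h0
  · rw [hK i (by omega)]
    exact congrArg x.1 (by omega)
  · rw [hK (i + k.natAbs) (by omega)]
    exact congrArg x.1 (by omega)

end

end Ferenczi

/-! ### Automorphisms of minimal systems -/

namespace TopDyn

/-- A homeomorphism that commutes with a minimal `T` and keeps some point asymptotic to its image
under a power of `T` is that power. -/
theorem eq_zpow_of_isAsymptotic {X : Type*} [UniformSpace X] [CompactSpace X] [T2Space X]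
    {T φ : X ≃ₜ X} (hmin : IsMinimal T) (hφ : ∀ x, φ (T x) = T (φ x)) {x : X} {k : ℤ}
    (h : IsAsymptotic T ((T ^ k) x) (φ x)) : φ = T ^ k := by
  have hpow : ∀ (n : ℕ) (x : X), φ ((T ^ n) x) = (T ^ n) (φ x) := by
    intro n
    induction n with
    | zero => intro x; rfl
    | succ n ih =>
      intro x
      rw [pow_succ]
      change φ ((T ^ n) (T x)) = (T ^ n) (T (φ x))
      rw [ih, hφ]
  have hcomm : Commute T φ := Homeomorph.ext fun x => (hφ x).symm
  -- Along an ultrafilter the forward orbit of `x` converges to some `z`; asymptoticity then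
  -- identifies the limits `φ z` and `(T ^ k) z`.
  let U : Ultrafilter ℕ := Ultrafilter.of atTop
  have hU : (U : Filter ℕ) ≤ atTop := Ultrafilter.of_le _
  obtain ⟨z, hz⟩ : ∃ z, Tendsto (fun n : ℕ => (T ^ n) x) U (𝓝 z) :=
    ⟨_, (U.map fun n : ℕ => (T ^ n) x).le_nhds_lim⟩
  have hTk : Tendsto (fun n : ℕ => (T ^ n) ((T ^ k) x)) U (𝓝 ((T ^ k) z)) := by
    have e : ∀ n : ℕ, (T ^ n) ((T ^ k) x) = (T ^ k) ((T ^ n) x) := fun n =>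
      congrArg (fun f : X ≃ₜ X => f x) (((Commute.refl T).pow_left n).zpow_right k).eq
    simp only [e]
    exact ((T ^ k).continuous.tendsto z).comp hz
  have hφz : Tendsto (fun n : ℕ => (T ^ n) (φ x)) U (𝓝 (φ z)) := by
    simp only [← hpow]
    exact (φ.continuous.tendsto z).comp hz
  have hzz : φ z = (T ^ k) z :=
    tendsto_nhds_unique hφz (hTk.congr_uniformity (h.mono_left hU))
  have hclosed : IsClosed {w | φ w = (T ^ k) w} := isClosed_eq φ.continuous (T ^ k).continuous
  have hsub : (Set.range fun n : ℤ => (T ^ n) z) ⊆ {w | φ w = (T ^ k) w} := by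
    rintro _ ⟨n, rfl⟩
    have e1 : φ ((T ^ n) z) = (T ^ n) (φ z) :=
      congrArg (fun f : X ≃ₜ X => f z) (hcomm.symm.zpow_right n).eq
    have e2 : (T ^ k) ((T ^ n) z) = (T ^ n) ((T ^ k) z) :=
      congrArg (fun f : X ≃ₜ X => f z) (Commute.zpow_zpow_self T k n).eq
    change φ ((T ^ n) z) = (T ^ k) ((T ^ n) z)
    rw [e1, e2, hzz]
  refine Homeomorph.ext fun w => ?_
  have := hclosed.closure_subset_iff.2 hsub (hmin z w)
  exact this

end TopDyn

theorem mainTheorem10 (q : ℕ → ℕ) (a : ℕ → ℕ → ℕ)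
    (hne : (Ferenczi.subshift q a).Nonempty)
    (hmin : TopDyn.IsMinimal (Ferenczi.shift q a))
    (haper : TopDyn.IsAperiodic (Ferenczi.shift q a)) :
    (∃! C : Set (Ferenczi.subshift q a), TopDyn.IsAsymptoticClass (Ferenczi.shift q a) C) ∧
      TopDyn.automorphismGroup (Ferenczi.shift q a) =
        Subgroup.zpowers (Ferenczi.shift q a) := by
  obtain ⟨x, y, hxy, hasy⟩ := Ferenczi.exists_isAsymptotic_pair hne haper
  set T := Ferenczi.shift q a with hT
  have hadd : ∀ (j k : ℤ) z, (T ^ j) ((T ^ k) z) = (T ^ (j + k)) z := by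
    intro j k z
    rw [zpow_add]
    rfl
  refine ⟨⟨{z | (TopDyn.asymptoticSetoid T) z x}, ⟨⟨x, rfl⟩, ?_⟩, ?_⟩, le_antisymm ?_ ?_⟩
  -- If the class were one orbit, `x` and `y` would be different shifts of one point, yet
  -- asymptotic.
  · intro u hu
    have hx : x ∈ {z | (TopDyn.asymptoticSetoid T) z x} := (TopDyn.asymptoticSetoid T).refl x
    have hy : y ∈ {z | (TopDyn.asymptoticSetoid T) z x} :=
      (TopDyn.asymptoticSetoid T).symm ⟨0, hasy⟩
    rw [hu] at hx hy
    obtain ⟨i, rfl⟩ := hx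
    obtain ⟨j, rfl⟩ := hy
    refine Ferenczi.not_isAsymptotic_zpow haper ((T ^ i) u) (k := j - i) ?_ ?_
    · rw [sub_ne_zero]
      rintro rfl
      exact hxy rfl
    · rw [← hT, hadd, sub_add_cancel]
      exact hasy
  · rintro _ ⟨⟨x', rfl⟩, hC⟩
    -- A class larger than the orbit of `x'` yields a nontrivial asymptotic pair, comparable with
    -- `(x, y)`.
    obtain ⟨y', ⟨k, hk⟩, hy'⟩ : ∃ y', (TopDyn.asymptoticSetoid T) y' x' ∧
        y' ∉ Set.range fun n : ℤ => (T ^ n) x' := by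
      by_contra! h
      refine hC x' (Set.Subset.antisymm h ?_)
      rintro _ ⟨n, rfl⟩
      exact ⟨n, tendsto_diag_uniformity (fun m : ℕ => (T ^ m) ((T ^ n) x')) atTop⟩
    obtain ⟨l, hl⟩ := Ferenczi.equivalent_of_isAsymptotic haper hxy hasy
      (fun h => hy' ⟨k, h.symm⟩) hk
    have h1 : (TopDyn.asymptoticSetoid T) x' x :=
      (TopDyn.asymptoticSetoid T).trans
        ((TopDyn.asymptoticSetoid T).symm ⟨k, hk⟩) ((TopDyn.asymptoticSetoid T).symm ⟨l, hl⟩)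
    ext z
    exact ⟨fun h => (TopDyn.asymptoticSetoid T).trans h h1,
      fun h => (TopDyn.asymptoticSetoid T).trans h ((TopDyn.asymptoticSetoid T).symm h1)⟩
  · intro φ hφ
    have hpow : ∀ (n : ℕ) z, φ ((T ^ n) z) = (T ^ n) (φ z) := by
      intro n z
      have hcomm : Commute T φ := Homeomorph.ext fun x => (hφ x).symm
      exact congrArg (fun f => f z) (hcomm.symm.pow_right n).eq
    -- By compactness `φ` is uniformly continuous, so it preserves asymptotic pairs.
    have hφasy : TopDyn.IsAsymptotic T (φ x) (φ y) := by
      have := Tendsto.comp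
        (CompactSpace.uniformContinuous_of_continuous φ.continuous) hasy
      simp only [Function.comp_def, hpow] at this
      exact this
    obtain ⟨k, hk⟩ := Ferenczi.equivalent_of_isAsymptotic haper (φ.injective.ne hxy) hφasy hxy hasy
    exact ⟨k, (TopDyn.eq_zpow_of_isAsymptotic hmin hφ (tendsto_swap_uniformity.comp hk)).symm⟩
  · rw [Subgroup.zpowers_le]
    exact fun _ => rfl
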